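/- Let $B>0$ and let $\mathcal F$ be the set of probability distributions on $\mathbb R$ with support in $[0,B]$. For $F\in\mathcal F$ and $\mu\in[0,B]$ let $$K_{\inf}^+(F,\mu)=\inf\{\mathrm{KL}(F,G): G\in\mathcal F,\ \mathbb E_G[X]\ge\mu\},\qquad K_{\inf}^-(F,\mu)=\inf\{\mathrm{KL}(F,G): G\in\mathcal F,\ \mathbb E_G[X]\le\mu\}.$$ For integers $m,n\ge 1$ put $$c(m,n)=\frac{m^{m/2}}{2(8\pi)^{(m-1)/2}}\cdot\frac1{n^{(m+1)/2}} .$$ **Theorem.** Let $F^{(1)},F^{(2)}\in\mathcal F$ have means in $(0,B)$. For every $\varepsilon>0$ there is $\eta>0$ such that the following holds for all $n_1,n_2\ge1$ and all points $X^{(1)}_1,\dots,X^{(1)}_{n_1},X^{(2)}_1,\dots,X^{(2)}_{n_2}\in[0,B]$ such that $0$ is one of the points $X^{(1)}_i$ and $B$ is one of the points $X^{(2)}_i$. Let $F_n^{(1)},F_n^{(2)}$ be the empirical distributions of the two families of points, and let $\theta_1=\sum_i L^{(1)}_iX^{(1)}_i$ and $\theta_2=\sum_i L^{(2)}_iX^{(2)}_i$,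 where $L^{(1)}\sim\mathrm{Dir}(1,\dots,1)$ ($n_1$ ones) and $L^{(2)}\sim\mathrm{Dir}(1,\dots,1)$ ($n_2$ ones) are independent. If the cumulative distribution functions satisfy $\|F_n^{(1)}-F^{(1)}\|_\infty\le\eta$ and $\|F_n^{(2)}-F^{(2)}\|_\infty\le\eta$, then, with $M=2+\lfloor 2/\eta\rfloor$ and $M_i=\min(M,n_i)$, $$\mathbb P(\theta_2\ge\theta_1)\ \ge\ c(M_1,n_1)\,c(M_2,n_2)\,\exp\Big(-\inf_{\mu\in[0,B]}\big(n_1K_{\inf}^-(F^{(1)},\mu)+n_2K_{\inf}^+(F^{(2)},\mu)\big)-(n_1+n_2)\varepsilon\Big).$$ In particular, when $n_1,n_2\ge M$ the prefactor is $\dfrac{M^{M}}{4(8\pi)^{M-1}}\,\dfrac1{(n_1n_2)^{(M+1)/2}}$. -/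

import Mathlib

open MeasureTheory ProbabilityTheory Set
open scoped ENNReal

noncomputable section

/-- The set of probability distributions on the real line with support in `[0, B]`. -/
def boundedLaws (B : ℝ) : Set (Measure ℝ) :=
  {G | IsProbabilityMeasure G ∧ G (Icc 0 B)ᶜ = 0}

/-- `Kinf⁺(F, u) = inf {KL(F, G) | G supported in [0, B], E_G[X] ≥ u}`. -/
def KinfPlus (B : ℝ) (F : Measure ℝ) (u : ℝ) : ℝ≥0∞ :=
  ⨅ G ∈ {G : Measure ℝ | G ∈ boundedLaws B ∧ u ≤ ∫ x, x ∂G}, InformationTheory.klDiv F G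

/-- `Kinf⁻(F, u) = inf {KL(F, G) | G supported in [0, B], E_G[X] ≤ u}`. -/
def KinfMinus (B : ℝ) (F : Measure ℝ) (u : ℝ) : ℝ≥0∞ :=
  ⨅ G ∈ {G : Measure ℝ | G ∈ boundedLaws B ∧ ∫ x, x ∂G ≤ u}, InformationTheory.klDiv F G

/-- The density of the Dirichlet distribution `Dir(α)` at the point `y` of the hyperplane
`∑ i, y i = 1` (it vanishes outside the simplex). -/
def dirichletDensity {n : ℕ} (α : Fin n → ℝ) (y : Fin n → ℝ) : ℝ≥0∞ :=
  if ∀ i, 0 ≤ y i then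
    ENNReal.ofReal
      (Real.Gamma (∑ i, α i) / (∏ i, Real.Gamma (α i)) * ∏ i, (y i) ^ (α i - 1))
  else 0

/-- The point `(x₁, …, x_k, 1 - x₁ - ⋯ - x_k)`. -/
def completeToSimplex {k : ℕ} (x : Fin k → ℝ) : Fin (k + 1) → ℝ :=
  Fin.snoc (α := fun _ => ℝ) x (1 - ∑ i, x i)

/-- The Dirichlet distribution `Dir(α)`, `α = (α₁, …, α_n)` with `n ≥ 1`: the first `n - 1`
coordinates have density `dirichletDensity` with respect to the Lebesgue measure, and the last
coordinate is one minus their sum. -/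
def dirichlet : {n : ℕ} → (Fin n → ℝ) → Measure (Fin n → ℝ)
  | 0, _ => 0
  | k + 1, α =>
    ((volume : Measure (Fin k → ℝ)).withDensity
      (fun x => dirichletDensity α (completeToSimplex x))).map completeToSimplex

/-- The empirical distribution of the points `X₁, …, X_n`. -/
def empiricalLaw {n : ℕ} (X : Fin n → ℝ) : Measure ℝ :=
  (n : ℝ≥0∞)⁻¹ • ∑ i, Measure.dirac (X i)

/-- The sup-norm distance of the cumulative distribution functions. -/
def cdfDist (F G : Measure ℝ) : ℝ :=
  ⨆ x : ℝ, |cdf F x - cdf G x|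

/-- `m^{m/2} / (2 (8π)^{(m-1)/2}) · n^{-(m+1)/2}`. -/
def polyFactor (m n : ℕ) : ℝ :=
  (m : ℝ) ^ ((m : ℝ) / 2) / (2 * (8 * Real.pi) ^ (((m : ℝ) - 1) / 2))
    * (1 / (n : ℝ) ^ (((m : ℝ) + 1) / 2))

end

/-!
Fix a level `u` and competitors `G₁`, `G₂` with means at most, respectively at least, `u`. By
independence the probability of `θ₁ ≤ θ₂` is at least the product of those of `θ₁ ≤ u` and
`u ≤ θ₂`, and `x ↦ B - x` turns the first of these events into one of the second kind, so it
suffices to bound the probability of `u ≤ θ` from below by about `exp (-n KL(F, G))`.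

`Dir(1, …, 1)` is the uniform distribution on the simplex. Sort the points into finitely many cells
and let `p` be weights of the cells whose mean, computed with the lower ends of the cells, is at
least `u`. Among the points is the largest value `B`; keeping its weight as the free coordinate,
the event contains every weight vector whose mass in each cell is at most `p`, since missing mass
goes to `B`. That set is a product of simplices of explicit volume (`volume_groupSimplex`,
`ofReal_prod_le_dirichlet_one`). The result is a multinomial probability up to the factor `1 / n`,
and Stirling's formula with the inequality of the means bounds it by the polynomial factor times
`exp (-n KL)` of the frequencies relative to `p` (`polyFactor_mul_exp_le_multinomial`). The bound
obtained for the number of occupied cells implies the one for any larger number up to `n`, so the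
grid may be fixed in terms of `F₁`, `F₂` and `ε`, and `η` is chosen small afterwards.

The weights `p` come from the cell masses of `G` by mixing in a little mass at `B`, to compensate
for rounding down, and a little uniform mass, to make the relative entropy continuous in the
frequencies. Data processing bounds the relative entropy of the cell masses by `KL(F, G)`. This
gives `exists_polyFactor_mul_exp_le_dirichlet_one`, uniformly in `u ≤ U` for each `U < B`.
Uniformity fails as `u` tends to `B`, where the relative entropy tends to infinity; but only levels
between `min (m₁, m₂)` and `m₁` matter, for `m₁`, `m₂` the means of `F₁`, `F₂`
(`exists_competitors_of_level`), and these stay away from `0` and `B`. Finally the infimum over the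
levels and competitors is finite, so it passes to real numbers.
-/

/-! ### Volumes of products of simplices -/

lemma lintegral_scaled_pow_sub (C p : ℝ) (hC : 0 ≤ C) (hp : 0 ≤ p) (a : ℕ) :
    ∫⁻ t in Icc 0 p, ENNReal.ofReal (C * ((p - t) ^ a / (a.factorial : ℝ)))
      = ENNReal.ofReal (C * (p ^ (a + 1) / ((a + 1).factorial : ℝ))) := by
  rw [← ofReal_integral_eq_lintegral_ofReal]
  · congr 1
    rw [integral_Icc_eq_integral_Ioc, ← intervalIntegral.integral_of_le hp,
      intervalIntegral.integral_const_mul, intervalIntegral.integral_div,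
      intervalIntegral.integral_comp_sub_left (fun x => x ^ a) p, integral_pow]
    rw [Nat.factorial_succ]
    push_cast
    simp only [sub_self, sub_zero, ne_eq, Nat.succ_ne_zero, not_false_eq_true, zero_pow]
    field_simp
  · exact (Continuous.integrableOn_Icc (by fun_prop))
  · filter_upwards [ae_restrict_mem measurableSet_Icc] with t ht
    have : 0 ≤ p - t := sub_nonneg.2 ht.2
    positivity

/-- A product of solid simplices: the nonnegative vectors whose coordinates in the group `j`
(the fibre of `g` over `j`) add up to at most `p j`. -/
def groupSimplex {J : Type*} [Fintype J] [DecidableEq J] {k : ℕ} (g : Fin k → J) (p : J → ℝ) :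
    Set (Fin k → ℝ) :=
  {x | (∀ i, 0 ≤ x i) ∧ ∀ j, ∑ i with g i = j, x i ≤ p j}

section
variable {J : Type*} [Fintype J] [DecidableEq J]

lemma measurableSet_groupSimplex {k : ℕ} (g : Fin k → J) (p : J → ℝ) :
    MeasurableSet (groupSimplex g p) := by
  unfold groupSimplex
  apply IsClosed.measurableSet
  simp only [Set.ofPred_and, Set.ofPred_forall]
  refine IsClosed.inter (isClosed_iInter fun i => ?_) (isClosed_iInter fun j => ?_)
  · exact isClosed_le continuous_const (by fun_prop)
  · exact isClosed_le (by fun_prop) continuous_const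

lemma cons_mem_groupSimplex {k : ℕ} (g : Fin (k + 1) → J) (p : J → ℝ) (t : ℝ) (x : Fin k → ℝ) :
    (Fin.cons t x : Fin (k + 1) → ℝ) ∈ groupSimplex g p ↔
      0 ≤ t ∧ x ∈ groupSimplex (fun i => g i.succ) (Function.update p (g 0) (p (g 0) - t)) := by
  simp only [groupSimplex, Set.mem_ofPred_eq, Fin.forall_fin_succ, Fin.cons_zero, Fin.cons_succ,
    and_assoc, Finset.sum_filter, Fin.sum_univ_succ]
  refine and_congr_right fun _ => and_congr_right fun _ => forall_congr' fun j => ?_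
  by_cases h : g 0 = j
  · subst h
    simp only [if_true, Function.update_self, le_sub_iff_add_le']
  · rw [Function.update_of_ne (Ne.symm h)]
    simp only [h, if_false, zero_add]

/-- The volume of a product of solid simplices, by slicing along the first coordinate. -/
lemma volume_groupSimplex {k : ℕ} (g : Fin k → J) (p : J → ℝ) (hp : ∀ j, 0 ≤ p j) :
    volume (groupSimplex g p)
      = ENNReal.ofReal (∏ j, p j ^ (Finset.univ.filter (g · = j)).card /
          ((Finset.univ.filter (g · = j)).card.factorial : ℝ)) := by
  induction k generalizing p with
  | zero =>
    have : groupSimplex g p = Set.univ := by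
      ext x; simp [groupSimplex, hp]
    rw [this]
    simp [volume_pi]
  | succ k ih =>
    have e := (volume_preserving_piFinSuccAbove (fun _ : Fin (k + 1) => ℝ) 0).symm
    rw [← e.measure_preimage (measurableSet_groupSimplex g p).nullMeasurableSet,
      Measure.volume_eq_prod, Measure.prod_apply
        (e.measurable (measurableSet_groupSimplex g p))]
    have hsec : ∀ t : ℝ, Prod.mk t ⁻¹'
        ((MeasurableEquiv.piFinSuccAbove (fun _ : Fin (k + 1) => ℝ) 0).symm ⁻¹' groupSimplex g p)
        = {x | 0 ≤ t ∧ x ∈ groupSimplex (fun i => g i.succ)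
            (Function.update p (g 0) (p (g 0) - t))} := by
      intro t
      ext x
      have := cons_mem_groupSimplex g p t x
      simp only [Set.mem_preimage, Set.mem_ofPred_eq, ← this]
      simp [MeasurableEquiv.piFinSuccAbove, Fin.insertNthEquiv]
    set α : J → ℕ := fun j => (Finset.univ.filter fun i : Fin k => g i.succ = j).card with hα
    set C : ℝ := ∏ j ∈ Finset.univ.erase (g 0), p j ^ α j / ((α j).factorial : ℝ) with hC
    have hC0 : 0 ≤ C := Finset.prod_nonneg fun j _ => by have := hp j; positivity
    have hvol : ∀ t : ℝ, volume (Prod.mk t ⁻¹'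
        ((MeasurableEquiv.piFinSuccAbove (fun _ : Fin (k + 1) => ℝ) 0).symm ⁻¹' groupSimplex g p))
        = (Icc 0 (p (g 0))).indicator (fun t => ENNReal.ofReal
            (C * ((p (g 0) - t) ^ α (g 0) / ((α (g 0)).factorial : ℝ)))) t := by
      intro t
      rw [hsec]
      by_cases ht : t ∈ Icc 0 (p (g 0))
      · rw [Set.indicator_of_mem ht]
        simp only [ht.1, true_and, Set.ofPred_mem_eq]
        rw [ih]
        · rw [← Finset.mul_prod_erase _ _ (Finset.mem_univ (g 0)), mul_comm]
          congr 2
          · refine Finset.prod_congr rfl fun j hj => ?_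
            rw [Function.update_of_ne (Finset.ne_of_mem_erase hj)]
          · rw [Function.update_self]
        · intro j
          by_cases h : j = g 0
          · subst h; simpa using ht.2
          · rw [Function.update_of_ne h]; exact hp j
      · rw [Set.indicator_of_notMem ht]
        convert measure_empty (μ := (volume : Measure (Fin k → ℝ)))
        ext x
        simp only [Set.mem_ofPred_eq, Set.mem_empty_iff_false, iff_false, not_and]
        intro h0 hx
        apply ht
        refine ⟨h0, ?_⟩
        have h1 := hx.2 (g 0)
        rw [Function.update_self] at h1
        have h2 : 0 ≤ ∑ i with g i.succ = g 0, x i := Finset.sum_nonneg fun i _ => hx.1 i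
        linarith
    simp_rw [hvol]
    rw [lintegral_indicator measurableSet_Icc, lintegral_scaled_pow_sub _ _ hC0 (hp _)]
    congr 1
    rw [← Finset.mul_prod_erase _ _ (Finset.mem_univ (g 0)), mul_comm]
    have hcard : ∀ j, (Finset.univ.filter (g · = j)).card
        = (if g 0 = j then 1 else 0) + α j := by
      intro j
      simp only [hα, Finset.card_filter, Fin.sum_univ_succ]
    congr 1
    · rw [hcard, if_pos rfl, add_comm (α (g 0)) 1]
    · refine Finset.prod_congr rfl fun j hj => ?_
      rw [hcard, if_neg (Ne.symm (Finset.ne_of_mem_erase hj)), zero_add]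

end

/-! ### The uniform distribution on the simplex -/

lemma measurable_completeToSimplex (k : ℕ) :
    Measurable (completeToSimplex : (Fin k → ℝ) → Fin (k + 1) → ℝ) := by
  rw [measurable_pi_iff]
  intro i
  unfold completeToSimplex
  refine Fin.lastCases ?_ (fun j => ?_) i
  · simp only [Fin.snoc_last]; fun_prop
  · simp only [Fin.snoc_castSucc]; fun_prop

/-- `Dir(1, …, 1)` is the uniform distribution on the simplex, whose projection to the first `k`
coordinates has volume `1 / k!`. -/
lemma dirichlet_one_apply {k : ℕ} {S : Set (Fin (k + 1) → ℝ)} (hS : MeasurableSet S) :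
    dirichlet (fun _ : Fin (k + 1) => (1 : ℝ)) S = ENNReal.ofReal (k.factorial : ℝ) *
      volume {x : Fin k → ℝ | completeToSimplex x ∈ {y | (∀ i, 0 ≤ y i) ∧ y ∈ S}} := by
  have hm := measurable_completeToSimplex k
  have hN : MeasurableSet {y : Fin (k + 1) → ℝ | ∀ i, 0 ≤ y i} := by
    simp only [Set.ofPred_forall]
    exact MeasurableSet.iInter fun i => measurableSet_le measurable_const (measurable_pi_apply i)
  have hd : ∀ x : Fin k → ℝ,
      dirichletDensity (fun _ : Fin (k + 1) => (1 : ℝ)) (completeToSimplex x)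
      = (completeToSimplex ⁻¹' {y : Fin (k + 1) → ℝ | ∀ i, 0 ≤ y i}).indicator
        (fun _ => ENNReal.ofReal (k.factorial : ℝ)) x := by
    intro x
    simp [dirichletDensity, Set.indicator, Real.Gamma_nat_eq_factorial]
  rw [dirichlet, Measure.map_apply hm hS, withDensity_apply _ (hm hS)]
  simp_rw [hd]
  rw [lintegral_indicator (hm hN), lintegral_const, Measure.restrict_restrict (hm hN),
    Measure.restrict_apply_univ]
  rfl

/-- Replacing the coordinate `i` of a point of the simplex by the omitted coordinate preserves
volume: the linear part of this affine map is an involution, so its determinant is `±1`. -/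
lemma volume_preimage_update_one_sub_sum {k : ℕ} (i : Fin k) (S : Set (Fin k → ℝ)) :
    volume {x : Fin k → ℝ | Function.update x i (1 - ∑ j, x j) ∈ S} = volume S := by
  let φ : (Fin k → ℝ) →ₗ[ℝ] ℝ :=
    LinearMap.proj (R := ℝ) (φ := fun _ : Fin k => ℝ) i + ∑ j : Fin k, LinearMap.proj j
  let A : (Fin k → ℝ) →ₗ[ℝ] (Fin k → ℝ) :=
    LinearMap.id - (LinearMap.single ℝ (fun _ : Fin k => ℝ) i).comp φ
  have hφ : ∀ x, φ x = x i + ∑ j, x j := fun x => by simp [φ]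
  have hA : ∀ x, A x = x - Pi.single i (x i + ∑ j, x j) := fun x => by
    simp [A, hφ]
  have hinv : A.comp A = LinearMap.id := by
    apply LinearMap.ext
    intro x
    simp only [LinearMap.comp_apply, LinearMap.id_apply]
    rw [hA (A x), hA x]
    simp only [Pi.sub_apply, Pi.single_eq_same, Finset.sum_sub_distrib, Finset.sum_pi_single',
      Finset.mem_univ, if_true]
    rw [sub_sub, ← Pi.single_add]
    simp
  have hdet : LinearMap.det A * LinearMap.det A = 1 := by
    rw [← LinearMap.det_comp, hinv, LinearMap.det_id]
  have hne : LinearMap.det A ≠ 0 := fun h => by simp [h] at hdet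
  have habs : |(LinearMap.det A)⁻¹| = 1 := by
    rw [abs_inv]
    have := (mul_self_eq_one_iff.1 hdet)
    rcases this with h | h <;> simp [h]
  have heq : {x : Fin k → ℝ | Function.update x i (1 - ∑ j, x j) ∈ S}
      = A ⁻¹' ((fun x => x + Pi.single i 1) ⁻¹' S) := by
    ext x
    simp only [Set.mem_ofPred_eq, Set.mem_preimage]
    have : Function.update x i (1 - ∑ j, x j) = A x + Pi.single i 1 := by
      rw [hA]
      ext j
      by_cases h : j = i
      · subst h; simp; ring
      · simp [h]
    rw [this]
  rw [heq, Measure.addHaar_preimage_linearMap _ hne, habs, ENNReal.ofReal_one, one_mul,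
    measure_preimage_add_right]

lemma completeToSimplex_update {k : ℕ} (i : Fin k) (x : Fin k → ℝ) :
    completeToSimplex (Function.update x i (1 - ∑ j, x j))
      = completeToSimplex x ∘ Equiv.swap i.castSucc (Fin.last k) := by
  have hs : ∑ j, Function.update x i (1 - ∑ j, x j) j = 1 - x i := by
    rw [Finset.sum_update_of_mem (Finset.mem_univ i), ← Finset.erase_eq,
      ← Finset.add_sum_erase _ _ (Finset.mem_univ i)]
    ring
  ext l
  unfold completeToSimplex
  rw [hs]
  refine Fin.lastCases ?_ (fun j => ?_) l
  · simp
  · by_cases h : j = i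
    · subst h; simp
    · have h1 : j.castSucc ≠ i.castSucc := fun h' => h (Fin.castSucc_injective _ h')
      have h2 : j.castSucc ≠ Fin.last k := (Fin.castSucc_lt_last j).ne
      simp [Equiv.swap_apply_of_ne_of_ne h1 h2, h]

lemma dirichlet_one_swap {k : ℕ} (i : Fin (k + 1)) {S : Set (Fin (k + 1) → ℝ)}
    (hS : MeasurableSet S) :
    dirichlet (fun _ : Fin (k + 1) => (1 : ℝ)) {y | y ∘ Equiv.swap i (Fin.last k) ∈ S}
      = dirichlet (fun _ : Fin (k + 1) => (1 : ℝ)) S := by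
  have hS' : MeasurableSet {y : Fin (k + 1) → ℝ | y ∘ Equiv.swap i (Fin.last k) ∈ S} := by
    have : Measurable fun y : Fin (k + 1) → ℝ => y ∘ Equiv.swap i (Fin.last k) := by
      rw [measurable_pi_iff]
      intro j
      exact measurable_pi_apply _
    exact this hS
  rw [dirichlet_one_apply hS, dirichlet_one_apply hS']
  congr 1
  revert hS'
  refine Fin.lastCases (fun _ => ?_) (fun j _ => ?_) i
  · simp
  · rw [← volume_preimage_update_one_sub_sum j
      {x | completeToSimplex x ∈ {y | (∀ i, 0 ≤ y i) ∧ y ∈ S}}]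
    congr 1
    ext x
    simp only [Set.mem_ofPred_eq, completeToSimplex_update, Function.comp_apply]
    refine and_congr_left fun _ => ?_
    exact (Equiv.forall_congr_right (q := fun l => 0 ≤ completeToSimplex x l)
      (Equiv.swap j.castSucc (Fin.last k))).symm

section
variable {J : Type*} [Fintype J] [DecidableEq J]

lemma sum_mul_eq_sum_fiber_mul {n : ℕ} (g : Fin n → J) (y : Fin n → ℝ) (c : J → ℝ) :
    ∑ i, y i * c (g i) = ∑ j, (∑ i with g i = j, y i) * c j := by
  rw [← Finset.sum_fiberwise Finset.univ g]
  refine Finset.sum_congr rfl fun j _ => ?_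
  rw [Finset.sum_mul]
  refine Finset.sum_congr rfl fun i hi => ?_
  rw [(Finset.mem_filter.1 hi).2]

/-- If the last point is the largest value `B`, and moving every other point down to the lower end
`a` of its group leaves a mean of at least `u` under the weights `p`, then the product of simplices
with group masses at most `p` lies in the event. Since `B` is the largest value, mass missing from
a group only helps, being carried by the last point. -/
lemma ofReal_prod_le_dirichlet_one_last {k : ℕ} (X : Fin (k + 1) → ℝ) (B u : ℝ)
    (hlast : X (Fin.last k) = B) (g : Fin (k + 1) → J) (a p : J → ℝ)
    (ha : ∀ i, a (g i) ≤ X i) (haB : ∀ j, a j ≤ B)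
    (hp : ∀ j, 0 ≤ p j) (hp1 : ∑ j, p j = 1) (hu : u ≤ ∑ j, p j * a j) :
    ENNReal.ofReal ((1 / (k + 1 : ℝ)) * ((k + 1).factorial : ℝ) *
      ∏ j, p j ^ (Finset.univ.filter (g · = j)).card /
          ((Finset.univ.filter (g · = j)).card.factorial : ℝ))
      ≤ dirichlet (fun _ : Fin (k + 1) => (1 : ℝ)) {y | u ≤ ∑ i, y i * X i} := by
  have hS : MeasurableSet {y : Fin (k + 1) → ℝ | u ≤ ∑ i, y i * X i} :=
    measurableSet_le measurable_const (by fun_prop)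
  have hsub : groupSimplex (fun i : Fin k => g i.castSucc) p ⊆
      {x : Fin k → ℝ | completeToSimplex x ∈
        {y | (∀ i, 0 ≤ y i) ∧ y ∈ {y : Fin (k + 1) → ℝ | u ≤ ∑ i, y i * X i}}} := by
    intro x hx
    have hsum : ∑ i, x i ≤ 1 := by
      rw [← Finset.sum_fiberwise Finset.univ (fun i : Fin k => g i.castSucc), ← hp1]
      exact Finset.sum_le_sum fun j _ => hx.2 j
    refine ⟨fun i => ?_, ?_⟩
    · unfold completeToSimplex
      refine Fin.lastCases ?_ (fun j => ?_) i
      · simpa using hsum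
      · simpa using hx.1 j
    · change u ≤ ∑ i, completeToSimplex x i * X i
      rw [Fin.sum_univ_castSucc]
      simp only [completeToSimplex, Fin.snoc_castSucc, Fin.snoc_last, hlast]
      have h1 : ∑ i : Fin k, x i * X i.castSucc ≥ ∑ i : Fin k, x i * a (g i.castSucc) :=
        Finset.sum_le_sum fun i _ => mul_le_mul_of_nonneg_left (ha _) (hx.1 i)
      have h2 : ∑ i : Fin k, x i * (B - a (g i.castSucc)) ≤ ∑ j, p j * (B - a j) := by
        rw [sum_mul_eq_sum_fiber_mul (fun i : Fin k => g i.castSucc) x (fun j => B - a j)]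
        exact Finset.sum_le_sum fun j _ =>
          mul_le_mul_of_nonneg_right (hx.2 j) (sub_nonneg.2 (haB j))
      simp only [mul_sub, Finset.sum_sub_distrib, ← Finset.sum_mul, hp1] at h2
      linarith
  rw [dirichlet_one_apply hS]
  refine le_trans ?_ (mul_le_mul_right (measure_mono hsub) _)
  rw [volume_groupSimplex _ _ hp, ← ENNReal.ofReal_mul (by positivity)]
  apply ENNReal.ofReal_le_ofReal
  have hk : (1 / (k + 1 : ℝ)) * ((k + 1).factorial : ℝ) = k.factorial := by
    rw [Nat.factorial_succ]; push_cast; field_simp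
  rw [hk]
  refine mul_le_mul_of_nonneg_left ?_ (by positivity)
  refine Finset.prod_le_prod (fun j _ => by have := hp j; positivity) fun j _ => ?_
  have hpj : p j ≤ 1 := hp1 ▸ Finset.single_le_sum (fun j _ => hp j) (Finset.mem_univ j)
  -- The last point is missing from the count of its group, which only enlarges the volume, as
  -- `p j ≤ 1`.
  have hcard : (Finset.univ.filter fun i : Fin k => g i.castSucc = j).card
      ≤ (Finset.univ.filter (g · = j)).card := by
    simp only [Finset.card_filter, Fin.sum_univ_castSucc]
    exact Nat.le_add_right _ _
  have := hp j
  exact div_le_div₀ (by positivity) (pow_le_pow_of_le_one (hp j) hpj hcard) (by positivity)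
    (by exact_mod_cast Nat.factorial_le hcard)

lemma ofReal_prod_le_dirichlet_one {n : ℕ} (X : Fin n → ℝ) (B u : ℝ) (i₀ : Fin n)
    (hi₀ : X i₀ = B) (g : Fin n → J) (a p : J → ℝ)
    (ha : ∀ i, a (g i) ≤ X i) (haB : ∀ j, a j ≤ B)
    (hp : ∀ j, 0 ≤ p j) (hp1 : ∑ j, p j = 1) (hu : u ≤ ∑ j, p j * a j) :
    ENNReal.ofReal ((1 / (n : ℝ)) * (n.factorial : ℝ) *
      ∏ j, p j ^ (Finset.univ.filter (g · = j)).card /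
          ((Finset.univ.filter (g · = j)).card.factorial : ℝ))
      ≤ dirichlet (fun _ : Fin n => (1 : ℝ)) {y | u ≤ ∑ i, y i * X i} := by
  obtain _ | k := n
  · exact i₀.elim0
  set σ := Equiv.swap i₀ (Fin.last k) with hσ
  have hσl : σ (Fin.last k) = i₀ := Equiv.swap_apply_right _ _
  have hS : MeasurableSet {y : Fin (k + 1) → ℝ | u ≤ ∑ i, y i * X (σ i)} :=
    measurableSet_le measurable_const (by fun_prop)
  have hcard : ∀ j, (Finset.univ.filter (g · = j)).card
      = (Finset.univ.filter (fun i => (g ∘ σ) i = j)).card := fun j => by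
    simp only [Finset.card_filter]
    exact (Equiv.sum_comp σ fun i => if g i = j then 1 else 0).symm
  have h := ofReal_prod_le_dirichlet_one_last (X ∘ σ) B u (by simp [hσl, hi₀]) (g ∘ σ) a p
    (fun i => ha _) haB hp hp1 hu
  simp only [Function.comp_apply (f := X)] at h
  rw [← dirichlet_one_swap i₀ hS] at h
  simp only [← hcard] at h
  push_cast
  refine h.trans (le_of_eq ?_)
  congr 1
  ext y
  simp only [Set.mem_ofPred_eq, Function.comp_apply]
  rw [← hσ, Equiv.sum_comp σ fun i => y i * X i]

end

/-! ### Stirling's formula and the polynomial factor -/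

lemma log_factorial_le {n : ℕ} (hn : n ≠ 0) :
    Real.log (n.factorial : ℝ) ≤ n * Real.log n - n + 1 + Real.log n / 2 := by
  obtain ⟨k, rfl⟩ := Nat.exists_eq_succ_of_ne_zero hn
  have h := Stirling.log_stirlingSeq'_antitone (Nat.zero_le k)
  simp only [Function.comp_apply, Stirling.log_stirlingSeq_formula] at h
  have hk : (0 : ℝ) < (k.succ : ℝ) := by positivity
  rw [Real.log_mul two_ne_zero hk.ne', Real.log_div hk.ne' (Real.exp_ne_zero 1), Real.log_exp] at h
  simp at h
  push_cast
  linarith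

/-- The function `x ↦ x log (x / (e² n))` decreases on `[0, n]`; together with `e² ≤ 8π` this
compares the prefactor for `m` occupied groups with the one for a larger number `M`. -/
lemma mul_log_le_of_le {m M n : ℕ} (hm : 1 ≤ m) (hmM : m ≤ M) (hMn : M ≤ n) :
    (M : ℝ) * Real.log M - M * Real.log (8 * Real.pi) - M * Real.log n
      ≤ m * Real.log m - 2 * m - m * Real.log n := by
  have hm0 : (0 : ℝ) < m := by exact_mod_cast hm
  have hM0 : (0 : ℝ) < M := by exact_mod_cast hm.trans hmM
  have hmM' : (m : ℝ) ≤ M := by exact_mod_cast hmM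
  have h1 : Real.log M ≤ Real.log n := Real.log_le_log hM0 (by exact_mod_cast hMn)
  have h2 : m * (Real.log M - Real.log m) ≤ M - m := by
    rw [← Real.log_div hM0.ne' hm0.ne']
    have := Real.log_le_sub_one_of_pos (div_pos hM0 hm0)
    calc (m : ℝ) * Real.log (M / m) ≤ m * (M / m - 1) := by gcongr
      _ = M - m := by field_simp
  have h3 : 2 ≤ Real.log (8 * Real.pi) := by
    rw [Real.le_log_iff_exp_le (by positivity)]
    have he : Real.exp 2 = Real.exp 1 * Real.exp 1 := by rw [← Real.exp_add]; norm_num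
    have := Real.exp_one_lt_d9
    have := Real.exp_pos 1
    have := Real.pi_gt_three
    rw [he]
    nlinarith
  nlinarith [mul_le_mul_of_nonneg_left h3 hM0.le,
    mul_le_mul_of_nonneg_left h1 (sub_nonneg.2 hmM')]

lemma log_polyFactor {M n : ℕ} (hM : M ≠ 0) (hn : n ≠ 0) :
    Real.log (polyFactor M n) = M / 2 * Real.log M - M / 2 * Real.log (8 * Real.pi)
      + Real.log (2 * Real.pi) / 2 - (M + 1) / 2 * Real.log n := by
  have hM0 : (0 : ℝ) < M := by positivity
  have hn0 : (0 : ℝ) < n := by positivity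
  have hpi := Real.pi_pos
  unfold polyFactor
  rw [Real.log_mul (by positivity) (by positivity), Real.log_div (by positivity) (by positivity),
    Real.log_mul (by positivity) (by positivity), one_div, Real.log_inv,
    Real.log_rpow hM0, Real.log_rpow (by positivity), Real.log_rpow hn0]
  have : Real.log (8 * Real.pi) = 2 * Real.log 2 + Real.log (2 * Real.pi) := by
    rw [← Real.log_rpow two_pos, ← Real.log_mul (by positivity) (by positivity)]
    congr 1
    norm_num
    ring
  rw [this]
  ring

lemma polyFactor_pos {M n : ℕ} (hM : M ≠ 0) (hn : n ≠ 0) : 0 < polyFactor M n := by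
  have := Real.pi_pos
  unfold polyFactor
  positivity

lemma sum_log_le_card_mul_log {J : Type*} {S : Finset J} (hS : S.Nonempty) (w : J → ℝ)
    (hw : ∀ j ∈ S, 0 < w j) :
    ∑ j ∈ S, Real.log (w j) ≤ S.card * Real.log ((∑ j ∈ S, w j) / S.card) := by
  have hc : (0 : ℝ) < S.card := by exact_mod_cast hS.card_pos
  have hs : 0 < ∑ j ∈ S, w j := Finset.sum_pos hw hS
  set A := (∑ j ∈ S, w j) / S.card with hA
  have hA0 : 0 < A := div_pos hs hc
  have h : ∑ j ∈ S, (Real.log (w j) - Real.log A) ≤ ∑ j ∈ S, (w j / A - 1) := by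
    refine Finset.sum_le_sum fun j hj => ?_
    rw [← Real.log_div (hw j hj).ne' hA0.ne']
    exact Real.log_le_sub_one_of_pos (div_pos (hw j hj) hA0)
  rw [Finset.sum_sub_distrib, Finset.sum_sub_distrib, ← Finset.sum_div] at h
  simp only [Finset.sum_const, nsmul_eq_mul, mul_one] at h
  have h2 : (∑ j ∈ S, w j) / A = S.card := by
    rw [hA]; field_simp
  linarith

section
variable {J : Type*} [Fintype J]

/-- The value at the observed counts `α` of a multinomial probability with cell weights `p`: its
exponential rate is the relative entropy of the frequencies `α / n`, and the polynomial factor comes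
from Stirling's formula and the inequality of the means, applied to the nonzero counts. -/
lemma polyFactor_mul_exp_le_multinomial (α : J → ℕ) (p : J → ℝ) (hp : ∀ j, 0 < p j) {n M : ℕ}
    (hn : ∑ j, α j = n) (hn0 : n ≠ 0) (hmM : (Finset.univ.filter fun j => α j ≠ 0).card ≤ M)
    (hMn : M ≤ n) :
    polyFactor M n * Real.exp (-∑ j, α j * Real.log (α j / (n * p j)))
      ≤ (1 / (n : ℝ)) * (n.factorial : ℝ) * ∏ j, p j ^ α j / ((α j).factorial : ℝ) := by
  set S := Finset.univ.filter fun j => α j ≠ 0 with hS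
  have hSne : S.Nonempty := by
    by_contra h
    rw [Finset.not_nonempty_iff_eq_empty, hS, Finset.filter_eq_empty_iff] at h
    apply hn0
    rw [← hn]
    exact Finset.sum_eq_zero fun j _ => not_not.1 (h (Finset.mem_univ j))
  have hm1 : 1 ≤ S.card := hSne.card_pos
  have hM0 : M ≠ 0 := by omega
  have hnpos : (0 : ℝ) < n := by positivity
  have hprod : ∀ j, 0 < p j ^ α j / ((α j).factorial : ℝ) := fun j => by
    have := hp j
    positivity
  have hRpos : 0 < (1 / (n : ℝ)) * (n.factorial : ℝ) * ∏ j, p j ^ α j / ((α j).factorial : ℝ) :=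
    mul_pos (by positivity) (Finset.prod_pos fun j _ => hprod j)
  rw [← Real.log_le_log_iff (mul_pos (polyFactor_pos hM0 hn0) (Real.exp_pos _)) hRpos,
    Real.log_mul (polyFactor_pos hM0 hn0).ne' (Real.exp_ne_zero _), Real.log_exp,
    log_polyFactor hM0 hn0,
    Real.log_mul (by positivity) (Finset.prod_pos fun j _ => hprod j).ne',
    Real.log_mul (x := 1 / (n : ℝ)) (by positivity) (by positivity), one_div, Real.log_inv,
    Real.log_prod (fun j _ => (hprod j).ne')]
  have hterm : ∀ j, -(α j * Real.log (α j / (n * p j))) - α j * Real.log n + α j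
      - (if α j ≠ 0 then 1 + Real.log (α j) / 2 else 0)
      ≤ Real.log (p j ^ α j / ((α j).factorial : ℝ)) := by
    intro j
    by_cases h : α j = 0
    · simp [h]
    · have hα : (0 : ℝ) < α j := by positivity
      have := hp j
      rw [if_pos h, Real.log_div hα.ne' (by positivity), Real.log_mul hnpos.ne' (hp j).ne',
        Real.log_div (by positivity) (by positivity), Real.log_pow]
      linarith [log_factorial_le h]
  have hsum := Finset.sum_le_sum fun j (_ : j ∈ Finset.univ) => hterm j
  simp only [Finset.sum_sub_distrib, Finset.sum_add_distrib, Finset.sum_neg_distrib,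
    ← Finset.sum_mul] at hsum
  have hcast : ∑ j, (α j : ℝ) = n := by exact_mod_cast hn
  rw [← Finset.sum_filter, hcast, Finset.sum_add_distrib, ← Finset.sum_div] at hsum
  have hSsum : ∑ j ∈ S, (α j : ℝ) = n := by
    rw [← hcast, hS, Finset.sum_filter]
    refine Finset.sum_congr rfl fun j _ => ?_
    by_cases h : α j = 0 <;> simp [h]
  have hamgm := sum_log_le_card_mul_log hSne (fun j => (α j : ℝ))
    (fun j hj => by have := (Finset.mem_filter.1 hj).2; positivity)
  have hc : (0 : ℝ) < S.card := by exact_mod_cast hm1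
  rw [hSsum, Real.log_div hnpos.ne' hc.ne'] at hamgm
  have hst := Stirling.le_log_factorial_stirling hn0
  have hfin := mul_log_le_of_le hm1 hmM hMn
  simp only [Finset.sum_const, nsmul_eq_mul, mul_one, ← hS] at hsum
  linarith

end

/-! ### Relative entropy and frequencies on a finite partition -/

/-- The data processing inequality for the partition of the space into the fibres of `c`. -/
lemma sum_mul_log_le_toReal_klDiv {E J : Type*} [MeasurableSpace E] [Fintype J]
    [MeasurableSpace J] [MeasurableSingletonClass J] (F G : Measure E) [IsProbabilityMeasure F]
    [IsProbabilityMeasure G] {c : E → J} (hc : Measurable c)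
    (h : InformationTheory.klDiv F G ≠ ∞) :
    ∑ j, F.real (c ⁻¹' {j}) * Real.log (F.real (c ⁻¹' {j}) / G.real (c ⁻¹' {j}))
      ≤ (InformationTheory.klDiv F G).toReal := by
  refine le_trans (le_of_eq ?_)
    (ENNReal.toReal_mono h (InformationTheory.klDiv_map_le (μ := F) (ν := G) hc))
  have hac : F ≪ G := (InformationTheory.klDiv_ne_top_iff.1 h).1
  have hacm : F.map c ≪ G.map c := hac.map hc
  have : IsProbabilityMeasure (F.map c) := Measure.isProbabilityMeasure_map hc.aemeasurable
  have : IsProbabilityMeasure (G.map c) := Measure.isProbabilityMeasure_map hc.aemeasurable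
  rw [InformationTheory.toReal_klDiv_of_measure_eq hacm (by simp),
    integral_fintype Integrable.of_finite]
  refine Finset.sum_congr rfl fun j _ => ?_
  rw [map_measureReal_apply hc (measurableSet_singleton j), smul_eq_mul]
  by_cases h0 : F.real (c ⁻¹' {j}) = 0
  · simp [h0]
  · congr 2
    have h1 := Measure.setLIntegral_rnDeriv hacm {j}
    rw [lintegral_singleton, Measure.map_apply hc (measurableSet_singleton j),
      Measure.map_apply hc (measurableSet_singleton j)] at h1
    have h2 := congrArg ENNReal.toReal h1
    rw [ENNReal.toReal_mul] at h2
    have hG : G.real (c ⁻¹' {j}) ≠ 0 := by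
      intro hz
      apply h0
      rw [measureReal_def, ← h2]
      rw [measureReal_def] at hz
      rw [hz, mul_zero]
    rw [div_eq_iff hG]
    exact h2.symm

/-- Relative entropy with respect to weights in `[s, 1]` is uniformly continuous. -/
lemma exists_sum_mul_log_div_le_add {J : Type*} [Fintype J] [Nonempty J] {s ε : ℝ} (hs : 0 < s)
    (hε : 0 < ε) :
    ∃ δ > 0, ∀ f F p : J → ℝ, (∀ j, f j ∈ Icc 0 1) → (∀ j, F j ∈ Icc 0 1) →
      (∀ j, p j ∈ Icc s 1) → (∀ j, |f j - F j| ≤ δ) →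
      ∑ j, f j * Real.log (f j / p j) ≤ ∑ j, F j * Real.log (F j / p j) + ε := by
  have huc : UniformContinuousOn (fun z : ℝ × ℝ => z.1 * Real.log (z.1 / z.2))
      (Icc 0 1 ×ˢ Icc s 1) := by
    refine (isCompact_Icc.prod isCompact_Icc).uniformContinuousOn_of_continuous ?_
    have : ContinuousOn (fun z : ℝ × ℝ => z.1 * Real.log z.1 - z.1 * Real.log z.2)
        (Icc 0 1 ×ˢ Icc s 1) := by
      refine (Real.continuous_mul_log.comp continuous_fst).continuousOn.sub
        (continuousOn_fst.mul (continuousOn_snd.log ?_))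
      rintro z ⟨-, hz⟩
      exact (hs.trans_le hz.1).ne'
    refine this.congr ?_
    rintro z ⟨-, hz⟩
    have hz2 : z.2 ≠ 0 := (hs.trans_le hz.1).ne'
    by_cases h : z.1 = 0
    · simp [h]
    · simp only [Real.log_div h hz2]; ring
  have hc : (0 : ℝ) < Fintype.card J := by exact_mod_cast Fintype.card_pos
  obtain ⟨δ, hδ, H⟩ := Metric.uniformContinuousOn_iff.1 huc (ε / Fintype.card J) (div_pos hε hc)
  refine ⟨δ / 2, half_pos hδ, fun f F p hf hF hp hfF => ?_⟩
  have : ∀ j, f j * Real.log (f j / p j) ≤ F j * Real.log (F j / p j) + ε / Fintype.card J := by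
    intro j
    have h := H (f j, p j) ⟨hf j, hp j⟩ (F j, p j) ⟨hF j, hp j⟩ (by
      rw [Prod.dist_eq, dist_self, max_eq_left dist_nonneg, Real.dist_eq]
      linarith [hfF j])
    rw [Real.dist_eq] at h
    linarith [(abs_lt.1 h).2]
  calc ∑ j, f j * Real.log (f j / p j)
      ≤ ∑ j, (F j * Real.log (F j / p j) + ε / Fintype.card J) :=
        Finset.sum_le_sum fun j _ => this j
    _ = _ := by
        rw [Finset.sum_add_distrib]
        simp
        field_simp

lemma sum_mul_log_div_le_of_mul_le {J : Type*} [Fintype J] {r : ℝ} (hr : 0 < r) (F q p : J → ℝ)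
    (hF : ∀ j, 0 ≤ F j) (hF1 : ∑ j, F j = 1) (hq : ∀ j, 0 ≤ q j) (hqF : ∀ j, q j = 0 → F j = 0)
    (hpq : ∀ j, r * q j ≤ p j) :
    ∑ j, F j * Real.log (F j / p j) ≤ ∑ j, F j * Real.log (F j / q j) - Real.log r := by
  rw [← one_mul (Real.log r), ← hF1, Finset.sum_mul, ← Finset.sum_sub_distrib]
  refine Finset.sum_le_sum fun j _ => ?_
  by_cases h : F j = 0
  · simp [h]
  · have hqj : 0 < q j := lt_of_le_of_ne (hq j) fun h' => h (hqF j h'.symm)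
    have hpj : 0 < p j := lt_of_lt_of_le (mul_pos hr hqj) (hpq j)
    rw [← mul_sub, Real.log_div h hpj.ne', Real.log_div h hqj.ne']
    refine mul_le_mul_of_nonneg_left ?_ (hF j)
    have := Real.log_le_log (mul_pos hr hqj) (hpq j)
    rw [Real.log_mul hr.ne' hqj.ne'] at this
    linarith

/-- The cell of a point of `[0, B]`: the half-open intervals `[jB/N, (j+1)B/N)`, `j < N`, and the
point `B`, which is the cell `N`. -/
noncomputable def gridCell (B : ℝ) (N : ℕ) (x : ℝ) : Fin (N + 1) :=
  ⟨min ⌊N * x / B⌋₊ N, Nat.lt_succ_of_le (min_le_right _ _)⟩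

lemma measurable_gridCell (B : ℝ) (N : ℕ) : Measurable (gridCell B N) := by
  have h : Measurable fun x : ℝ => ⌊N * x / B⌋₊ := Nat.measurable_floor.comp (by fun_prop)
  exact (Measurable.of_discrete (f := fun k : ℕ =>
    (⟨min k N, Nat.lt_succ_of_le (min_le_right _ _)⟩ : Fin (N + 1)))).comp h

lemma gridCell_mul_le {B : ℝ} (hB : 0 < B) {N : ℕ} (hN : N ≠ 0) {x : ℝ} (hx : 0 ≤ x) :
    ((gridCell B N x : ℕ) : ℝ) * B / N ≤ x := by
  have hN' : (0 : ℝ) < N := by positivity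
  have h : ((gridCell B N x : ℕ) : ℝ) ≤ N * x / B :=
    le_trans (by exact_mod_cast min_le_left _ _) (Nat.floor_le (by positivity))
  rw [le_div_iff₀ hB] at h
  rw [div_le_iff₀ hN']
  linarith

lemma le_gridCell_mul_add {B : ℝ} (hB : 0 < B) {N : ℕ} (hN : N ≠ 0) {x : ℝ} (hx : x ≤ B) :
    x ≤ ((gridCell B N x : ℕ) : ℝ) * B / N + B / N := by
  have hN' : (0 : ℝ) < N := by positivity
  rw [← add_div, le_div_iff₀ hN']
  rcases le_total ⌊N * x / B⌋₊ N with h | h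
  · have h1 : (gridCell B N x : ℕ) = ⌊N * x / B⌋₊ := min_eq_left h
    have h2 := Nat.lt_floor_add_one (N * x / B)
    rw [div_lt_iff₀ hB] at h2
    rw [h1]
    linarith
  · have h1 : (gridCell B N x : ℕ) = N := min_eq_right h
    rw [h1]
    nlinarith

lemma abs_measureReal_gridCell_sub_le {B : ℝ} (hB : 0 < B) {N : ℕ} (hN : N ≠ 0)
    (F F' : Measure ℝ) [IsProbabilityMeasure F] [IsProbabilityMeasure F'] {η : ℝ}
    (h : ∀ x, |F.real (Iio x) - F'.real (Iio x)| ≤ η) (j : Fin (N + 1)) :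
    |F.real (gridCell B N ⁻¹' {j}) - F'.real (gridCell B N ⁻¹' {j})| ≤ 2 * η := by
  have hN' : (0 : ℝ) < N := by positivity
  have hη : 0 ≤ η := (abs_nonneg _).trans (h 0)
  let D : ℕ → Set ℝ := fun k => {x | (gridCell B N x : ℕ) < k}
  have hD : ∀ k, |F.real (D k) - F'.real (D k)| ≤ η := by
    intro k
    by_cases h0 : k = 0
    · simp [D, h0, hη]
    · by_cases hk : N < k
      · have : D k = univ := by
          ext x
          simp only [D, Set.mem_ofPred_eq, Set.mem_univ, iff_true]
          exact lt_of_le_of_lt (min_le_right _ _) hk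
        simp [this, hη]
      · have : D k = Iio (k * B / N) := by
          ext x
          simp only [D, Set.mem_ofPred_eq, Set.mem_Iio, gridCell, min_lt_iff, hk, or_false]
          rw [Nat.floor_lt' h0, div_lt_iff₀ hB, lt_div_iff₀ hN', mul_comm]
        rw [this]
        exact h _
  have hDm : ∀ k, MeasurableSet (D k) := fun k =>
    measurable_gridCell B N (MeasurableSet.of_discrete (s := {i : Fin (N + 1) | (i : ℕ) < k}))
  have heq : gridCell B N ⁻¹' {j} = D (j + 1) \ D j := by
    ext x
    simp only [D, Set.mem_preimage, Set.mem_singleton_iff, Set.mem_sdiff, Set.mem_ofPred_eq,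
      Fin.ext_iff]
    omega
  have hsub : D j ⊆ D (j + 1) := fun x (hx : (gridCell B N x : ℕ) < j) => Nat.lt_succ_of_lt hx
  rw [heq, measureReal_sdiff hsub (hDm _), measureReal_sdiff hsub (hDm _)]
  have h1 := abs_le.1 (hD j)
  have h2 := abs_le.1 (hD (j + 1))
  rw [abs_le]
  constructor <;> linarith [h1.1, h1.2, h2.1, h2.2]

lemma isProbabilityMeasure_empiricalLaw {n : ℕ} (hn : n ≠ 0) (X : Fin n → ℝ) :
    IsProbabilityMeasure (empiricalLaw X) := by
  constructor
  simp only [empiricalLaw, Measure.smul_apply, Measure.coe_finsetSum, Finset.sum_apply,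
    measure_univ, Finset.sum_const, Finset.card_univ, Fintype.card_fin, smul_eq_mul,
    nsmul_eq_mul, mul_one]
  exact ENNReal.inv_mul_cancel (by exact_mod_cast hn) (ENNReal.natCast_ne_top n)

lemma measureReal_empiricalLaw_fiber {n : ℕ} (X : Fin n → ℝ) {J : Type*} [DecidableEq J]
    [MeasurableSpace J] [MeasurableSingletonClass J] {c : ℝ → J} (hc : Measurable c) (j : J) :
    (empiricalLaw X).real (c ⁻¹' {j}) = (Finset.univ.filter fun i => c (X i) = j).card / n := by
  have : ∑ i, (Measure.dirac (X i)) (c ⁻¹' {j})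
      = ((Finset.univ.filter fun i => c (X i) = j).card : ℝ≥0∞) := by
    rw [Finset.card_filter]
    push_cast
    refine Finset.sum_congr rfl fun i _ => ?_
    rw [Measure.dirac_apply' _ (hc (measurableSet_singleton j))]
    by_cases h : c (X i) = j <;> simp [h]
  rw [measureReal_def, empiricalLaw, Measure.smul_apply, Measure.coe_finsetSum, Finset.sum_apply,
    this]
  simp [div_eq_inv_mul]

/-! ### The one-sided bound -/

lemma ae_mem_Icc_of_mem_boundedLaws {B : ℝ} {G : Measure ℝ} (hG : G ∈ boundedLaws B) :
    ∀ᵐ x ∂G, x ∈ Icc 0 B := hG.2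

lemma integrable_id_of_mem_boundedLaws {B : ℝ} {G : Measure ℝ} (hG : G ∈ boundedLaws B) :
    Integrable (fun x : ℝ => x) G := by
  have := hG.1
  refine Integrable.of_bound (by fun_prop) B ?_
  filter_upwards [ae_mem_Icc_of_mem_boundedLaws hG] with x hx
  rw [Real.norm_eq_abs, abs_of_nonneg hx.1]
  exact hx.2

lemma integral_le_sum_gridCell {B : ℝ} (hB : 0 < B) {N : ℕ} (hN : N ≠ 0) {G : Measure ℝ}
    (hG : G ∈ boundedLaws B) :
    ∫ x, x ∂G ≤ ∑ j : Fin (N + 1), G.real (gridCell B N ⁻¹' {j}) * (((j : ℕ) : ℝ) * B / N)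
      + B / N := by
  have := hG.1
  have hm := measurable_gridCell B N
  have : IsProbabilityMeasure (G.map (gridCell B N)) :=
    Measure.isProbabilityMeasure_map hm.aemeasurable
  have hi : Integrable (fun x => ((gridCell B N x : ℕ) : ℝ) * B / N) G :=
    (integrable_map_measure (μ := G) (f := gridCell B N)
      (g := fun j : Fin (N + 1) => ((j : ℕ) : ℝ) * B / N)
      Measurable.of_discrete.aestronglyMeasurable hm.aemeasurable).1 Integrable.of_finite
  have h1 : ∫ x, ((gridCell B N x : ℕ) : ℝ) * B / N ∂G
      = ∑ j : Fin (N + 1), G.real (gridCell B N ⁻¹' {j}) * (((j : ℕ) : ℝ) * B / N) := by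
    rw [← integral_map (μ := G) (φ := gridCell B N) hm.aemeasurable
      (f := fun j : Fin (N + 1) => ((j : ℕ) : ℝ) * B / N)
      Measurable.of_discrete.aestronglyMeasurable, integral_fintype Integrable.of_finite]
    refine Finset.sum_congr rfl fun j _ => ?_
    rw [map_measureReal_apply hm (measurableSet_singleton j), smul_eq_mul]
  have h2 : ∫ x, x ∂G ≤ ∫ x, (((gridCell B N x : ℕ) : ℝ) * B / N + B / N) ∂G := by
    refine integral_mono_ae (integrable_id_of_mem_boundedLaws hG) (hi.add (integrable_const _)) ?_
    filter_upwards [ae_mem_Icc_of_mem_boundedLaws hG] with x hx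
    exact le_gridCell_mul_add hB hN hx.2
  rw [integral_add hi (integrable_const _), h1] at h2
  simpa using h2

lemma sum_measureReal_fiber {E J : Type*} [MeasurableSpace E] [Fintype J] [MeasurableSpace J]
    [MeasurableSingletonClass J] (F : Measure E) [IsProbabilityMeasure F] {c : E → J}
    (hc : Measurable c) : ∑ j, F.real (c ⁻¹' {j}) = 1 := by
  have : IsProbabilityMeasure (F.map c) := Measure.isProbabilityMeasure_map hc.aemeasurable
  have h := sum_measureReal_singleton (μ := F.map c) Finset.univ
  simp only [map_measureReal_apply hc (measurableSet_singleton _)] at h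
  rw [h]
  simp

/-- The mean of the lower ends of the cells under a mixture of grid weights `q`, a mass `t` at `B`
and uniform weights of total mass `s`. -/
lemma le_sum_mixture_mul {B : ℝ} (hB : 0 < B) {N : ℕ} (hN : N ≠ 0) {r s t u : ℝ} (hr : 0 ≤ r)
    (hs : 0 ≤ s) (q : Fin (N + 1) → ℝ)
    (hu : u ≤ ∑ j, q j * (((j : ℕ) : ℝ) * B / N) + B / N) :
    r * (u - B / N) + t * B ≤ ∑ j : Fin (N + 1),
      (r * q j + (if j = Fin.last N then t else 0) + s / (N + 1)) * (((j : ℕ) : ℝ) * B / N) := by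
  have hN' : (0 : ℝ) < N := by positivity
  simp only [add_mul, Finset.sum_add_distrib, ite_mul, zero_mul, Finset.sum_ite_eq',
    Finset.mem_univ, if_true, Fin.val_last]
  have h1 : 0 ≤ ∑ j : Fin (N + 1), s / (N + 1) * (((j : ℕ) : ℝ) * B / N) :=
    Finset.sum_nonneg fun j _ => by positivity
  have h2 : ∑ j, r * q j * (((j : ℕ) : ℝ) * B / N)
      = r * ∑ j, q j * (((j : ℕ) : ℝ) * B / N) := by
    rw [Finset.mul_sum]
    exact Finset.sum_congr rfl fun j _ => by ring
  have h3 : t * (N * B / N) = t * B := by field_simp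
  rw [h2, h3]
  have := mul_le_mul_of_nonneg_left (sub_le_iff_le_add.2 hu) hr
  linarith

/-- The one-sided bound for a fixed competitor `G`, uniform over the levels `u ≤ U` for a fixed
`U < B`. The competitor is reduced to a grid, and its grid weights are mixed with a small mass at
`B`, which restores the mean lost in rounding down, and with small uniform weights, which keep the
relative entropy continuous in the frequencies. -/
lemma exists_polyFactor_mul_exp_le_dirichlet_one {B : ℝ} (hB : 0 < B) {F : Measure ℝ}
    (hF : F ∈ boundedLaws B) {U ε : ℝ} (hU : U < B) (hε : 0 < ε) :
    ∃ η > 0, ∃ N : ℕ, ∀ (n : ℕ) (X : Fin n → ℝ), (∀ i, X i ∈ Icc 0 B) → (∃ i, X i = B) →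
      (∀ x, |(empiricalLaw X).real (Iio x) - F.real (Iio x)| ≤ η) →
      ∀ M, min N n ≤ M → M ≤ n → ∀ u ≤ U, ∀ G ∈ boundedLaws B, u ≤ ∫ x, x ∂G →
      InformationTheory.klDiv F G ≠ ∞ →
      ENNReal.ofReal (polyFactor M n *
          Real.exp (-(n * ((InformationTheory.klDiv F G).toReal + ε))))
        ≤ dirichlet (fun _ : Fin n => (1 : ℝ)) {y | u ≤ ∑ i, y i * X i} := by
  have := hF.1
  -- The mixing weights `t` and `s` satisfy `exp (-ε / 2) ≤ 1 - t - s`, so mixing costs at most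
  -- `ε / 2` in relative entropy.
  obtain ⟨t, ht0, ht⟩ : ∃ t > 0, 1 - 2 * t = Real.exp (-(ε / 2)) :=
    ⟨(1 - Real.exp (-(ε / 2))) / 2, by
      have : Real.exp (-(ε / 2)) < 1 := by
        rw [← Real.exp_zero]
        exact Real.exp_lt_exp.2 (by linarith)
      linarith, by ring⟩
  have hgap : 0 < t * (B - U) := mul_pos ht0 (sub_pos.2 hU)
  obtain ⟨s, hs0, hst, hsB⟩ : ∃ s > 0, s ≤ t ∧ s * B ≤ t * (B - U) / 2 :=
    ⟨min t (t * (B - U) / 2 / B), by positivity, min_le_left _ _, by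
      calc min t (t * (B - U) / 2 / B) * B ≤ t * (B - U) / 2 / B * B := by
            gcongr; exact min_le_right _ _
        _ = _ := by field_simp⟩
  obtain ⟨N, hN⟩ := exists_nat_ge (B / (t * (B - U) / 2))
  have hN' : (0 : ℝ) < N := lt_of_lt_of_le (by positivity) hN
  have hN0 : N ≠ 0 := by rintro rfl; simp at hN'
  have hBN : B / N ≤ t * (B - U) / 2 := by
    rw [div_le_iff₀ (by positivity)] at hN
    rw [div_le_iff₀ hN']
    linarith
  set r := 1 - t - s with hr
  have hr_ge : Real.exp (-(ε / 2)) ≤ r := by linarith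
  have hr0 : 0 < r := (Real.exp_pos _).trans_le hr_ge
  have hr1 : r ≤ 1 := by linarith
  have hlogr : -(ε / 2) ≤ Real.log r := (Real.le_log_iff_exp_le hr0).2 hr_ge
  obtain ⟨δ, hδ, H⟩ := exists_sum_mul_log_div_le_add (J := Fin (N + 1)) (s := s / (N + 1))
    (ε := ε / 2) (by positivity) (by positivity)
  refine ⟨δ / 2, by positivity, N + 1, fun n X hX ⟨i₀, hi₀⟩ hdist M hmM hMn u hu G hG huG hkl => ?_⟩
  have := hG.1
  have hn0 : n ≠ 0 := by rintro rfl; exact i₀.elim0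
  have hnpos : (0 : ℝ) < n := by positivity
  have := isProbabilityMeasure_empiricalLaw hn0 X
  have hc := measurable_gridCell B N
  let g : Fin n → Fin (N + 1) := fun i => gridCell B N (X i)
  let a : Fin (N + 1) → ℝ := fun j => ((j : ℕ) : ℝ) * B / N
  let q : Fin (N + 1) → ℝ := fun j => G.real (gridCell B N ⁻¹' {j})
  let w : Fin (N + 1) → ℝ := fun j => F.real (gridCell B N ⁻¹' {j})
  let f : Fin (N + 1) → ℝ := fun j => (empiricalLaw X).real (gridCell B N ⁻¹' {j})
  let p : Fin (N + 1) → ℝ := fun j => r * q j + (if j = Fin.last N then t else 0) + s / (N + 1)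
  have hq0 : ∀ j, 0 ≤ q j := fun j => measureReal_nonneg
  have hpq : ∀ j, r * q j ≤ p j := fun j => by
    have : 0 ≤ s / (N + 1) := by positivity
    simp only [p]
    split_ifs <;> linarith
  have hps : ∀ j, s / (N + 1) ≤ p j := fun j => by
    have := mul_nonneg hr0.le (hq0 j)
    simp only [p]
    split_ifs <;> linarith
  have hp0 : ∀ j, 0 < p j := fun j => lt_of_lt_of_le (by positivity) (hps j)
  have hp1 : ∑ j, p j = 1 := by
    simp only [p, Finset.sum_add_distrib, ← Finset.mul_sum, Finset.sum_ite_eq', Finset.mem_univ,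
      if_true, Finset.sum_const, Finset.card_univ, Fintype.card_fin, nsmul_eq_mul]
    rw [sum_measureReal_fiber G hc]
    push_cast
    field_simp
    linarith
  have hpu : u ≤ ∑ j, p j * a j := by
    refine le_trans ?_ (le_sum_mixture_mul hB hN0 (t := t) hr0.le hs0.le q
      (huG.trans (integral_le_sum_gridCell hB hN0 hG)))
    have h1 : r * (B / N) ≤ B / N := mul_le_of_le_one_left (by positivity) hr1
    have h2 : (t + s) * u ≤ (t + s) * U := by gcongr
    have h3 : s * U ≤ s * B := by gcongr
    rw [hr] at h1 ⊢
    nlinarith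
  have hα : ∀ j, ((Finset.univ.filter (g · = j)).card : ℝ) = n * f j := fun j => by
    simp only [f]
    rw [measureReal_empiricalLaw_fiber X hc, mul_div_cancel₀ _ hnpos.ne']
  have hsum : ∑ j, (Finset.univ.filter (g · = j)).card = n := by
    rw [← Finset.card_eq_sum_card_fiberwise (f := g) (s := Finset.univ) (t := Finset.univ)
      (fun _ _ => Finset.mem_univ _)]
    simp
  have hm : (Finset.univ.filter fun j => (Finset.univ.filter (g · = j)).card ≠ 0).card ≤ M := by
    refine le_trans (le_min ?_ ?_) hmM
    · simpa using Finset.card_le_univ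
        (Finset.univ.filter fun j => (Finset.univ.filter (g · = j)).card ≠ 0)
    · conv_rhs => rw [← hsum]
      rw [Finset.card_filter]
      exact Finset.sum_le_sum fun j _ => by split_ifs <;> omega
  have hkey := polyFactor_mul_exp_le_multinomial (fun j => (Finset.univ.filter (g · = j)).card) p
    hp0 hsum hn0 hm hMn
  have hdir := ofReal_prod_le_dirichlet_one X B u i₀ hi₀ g a p
    (fun i => gridCell_mul_le hB hN0 (hX i).1)
    (fun j => by
      have : ((j : ℕ) : ℝ) ≤ N := by exact_mod_cast Nat.lt_succ_iff.1 j.2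
      simp only [a]
      rw [div_le_iff₀ hN', mul_comm B]
      gcongr)
    (fun j => (hp0 j).le) hp1 hpu
  refine le_trans (ENNReal.ofReal_le_ofReal (le_trans ?_ hkey)) hdir
  refine mul_le_mul_of_nonneg_left (Real.exp_le_exp.2 (neg_le_neg ?_))
    (polyFactor_pos (fun h => ?_) hn0).le
  · have hent : ∑ j, ((Finset.univ.filter (g · = j)).card : ℝ) *
        Real.log ((Finset.univ.filter (g · = j)).card / (n * p j))
        = n * ∑ j, f j * Real.log (f j / p j) := by
      rw [Finset.mul_sum]
      refine Finset.sum_congr rfl fun j _ => ?_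
      rw [hα, mul_div_mul_left _ _ hnpos.ne', mul_assoc]
    rw [hent]
    refine mul_le_mul_of_nonneg_left ?_ hnpos.le
    have h1 := H f w p (fun j => ⟨measureReal_nonneg, measureReal_le_one⟩)
      (fun j => ⟨measureReal_nonneg, measureReal_le_one⟩)
      (fun j => ⟨hps j, hp1 ▸ Finset.single_le_sum (fun j _ => (hp0 j).le) (Finset.mem_univ j)⟩)
      (fun j => (abs_measureReal_gridCell_sub_le hB hN0 _ F hdist j).trans (by linarith))
    have h2 := sum_mul_log_div_le_of_mul_le hr0 w q p (fun j => measureReal_nonneg)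
      (sum_measureReal_fiber F hc) hq0 (fun j hj => by
        have hac := (InformationTheory.klDiv_ne_top_iff.1 hkl).1
        exact (measureReal_eq_zero_iff (by finiteness)).2
          (hac ((measureReal_eq_zero_iff (by finiteness)).1 hj))) hpq
    have h3 := sum_mul_log_le_toReal_klDiv F G hc hkl
    linarith
  · have : min (N + 1) n = 0 := by omega
    omega

/-! ### Reflection, finiteness of the relative entropy, and infima -/

lemma abs_measureReal_Iic_sub_le_cdfDist (F G : Measure ℝ) [IsProbabilityMeasure F]
    [IsProbabilityMeasure G] (x : ℝ) : |F.real (Iic x) - G.real (Iic x)| ≤ cdfDist F G := by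
  rw [← cdf_eq_real, ← cdf_eq_real]
  refine le_ciSup (f := fun x : ℝ => |cdf F x - cdf G x|) ⟨1, ?_⟩ x
  rintro _ ⟨y, rfl⟩
  rw [abs_le]
  constructor <;> linarith [cdf_nonneg F y, cdf_le_one F y, cdf_nonneg G y, cdf_le_one G y]

lemma tendsto_measureReal_Iic_sub (F : Measure ℝ) [IsProbabilityMeasure F] (x : ℝ) :
    Filter.Tendsto (fun n : ℕ => F.real (Iic (x - 1 / ((n : ℝ) + 1)))) Filter.atTop
      (nhds (F.real (Iio x))) := by
  have hmono : Monotone fun n : ℕ => Iic (x - 1 / ((n : ℝ) + 1)) := fun m n hmn =>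
    Iic_subset_Iic.2 (sub_le_sub_left (Nat.one_div_le_one_div hmn) x)
  have hU : ⋃ n : ℕ, Iic (x - 1 / ((n : ℝ) + 1)) = Iio x := by
    ext y
    simp only [Set.mem_iUnion, Set.mem_Iic, Set.mem_Iio]
    constructor
    · rintro ⟨n, hn⟩
      have : (0 : ℝ) < 1 / ((n : ℝ) + 1) := Nat.one_div_pos_of_nat
      linarith
    · intro hy
      obtain ⟨n, hn⟩ := exists_nat_one_div_lt (sub_pos.2 hy)
      exact ⟨n, by linarith⟩
  have h := tendsto_measure_iUnion_atTop (μ := F) hmono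
  rw [hU] at h
  exact (ENNReal.tendsto_toReal (measure_ne_top F _)).comp h

lemma abs_measureReal_Iio_sub_le {F G : Measure ℝ} [IsProbabilityMeasure F]
    [IsProbabilityMeasure G] {η : ℝ} (h : ∀ x, |F.real (Iic x) - G.real (Iic x)| ≤ η) (x : ℝ) :
    |F.real (Iio x) - G.real (Iio x)| ≤ η :=
  le_of_tendsto ((tendsto_measureReal_Iic_sub F x).sub (tendsto_measureReal_Iic_sub G x)).abs
    (Filter.Eventually.of_forall fun _ => h _)

lemma measurable_const_sub_real (B : ℝ) : Measurable fun x : ℝ => B - x := by fun_prop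

lemma map_sub_mem_boundedLaws {B : ℝ} {G : Measure ℝ} (hG : G ∈ boundedLaws B) :
    G.map (fun x => B - x) ∈ boundedLaws B := by
  have := hG.1
  have hm := measurable_const_sub_real B
  refine ⟨Measure.isProbabilityMeasure_map hm.aemeasurable, ?_⟩
  rw [Measure.map_apply hm measurableSet_Icc.compl]
  convert hG.2 using 2
  ext x
  simp only [Set.mem_preimage, Set.mem_compl_iff, Set.mem_Icc]
  constructor <;> intro h ⟨h1, h2⟩ <;> exact h ⟨by linarith, by linarith⟩

lemma integral_map_sub {B : ℝ} {G : Measure ℝ} (hG : G ∈ boundedLaws B) :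
    ∫ x, x ∂(G.map fun x => B - x) = B - ∫ x, x ∂G := by
  have := hG.1
  rw [integral_map (measurable_const_sub_real B).aemeasurable (by fun_prop),
    integral_sub (integrable_const _) (integrable_id_of_mem_boundedLaws hG)]
  simp

lemma measureReal_map_sub_Iio (B : ℝ) (F : Measure ℝ) [IsProbabilityMeasure F] (x : ℝ) :
    (F.map fun x => B - x).real (Iio x) = 1 - F.real (Iic (B - x)) := by
  rw [map_measureReal_apply (measurable_const_sub_real B) measurableSet_Iio,
    ← probReal_compl_eq_one_sub measurableSet_Iic]
  congr 1
  ext y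
  simp only [Set.mem_preimage, Set.mem_Iio, Set.mem_compl_iff, Set.mem_Iic, not_le]
  constructor <;> intro h <;> linarith

lemma empiricalLaw_comp {n : ℕ} (X : Fin n → ℝ) {f : ℝ → ℝ} (hf : Measurable f) :
    empiricalLaw (fun i => f (X i)) = (empiricalLaw X).map f := by
  ext S hS
  simp only [empiricalLaw, Measure.map_apply hf hS, Measure.smul_apply, Measure.coe_finsetSum,
    Finset.sum_apply, Measure.dirac_apply' _ hS, Measure.dirac_apply' _ (hf hS)]
  rfl

lemma sum_completeToSimplex {k : ℕ} (x : Fin k → ℝ) : ∑ i, completeToSimplex x i = 1 := by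
  rw [Fin.sum_univ_castSucc]
  simp [completeToSimplex]

lemma dirichlet_one_sub {n : ℕ} (hn : n ≠ 0) (X : Fin n → ℝ) (B u : ℝ) :
    dirichlet (fun _ : Fin n => (1 : ℝ)) {y | B - u ≤ ∑ i, y i * (B - X i)}
      = dirichlet (fun _ : Fin n => (1 : ℝ)) {y | ∑ i, y i * X i ≤ u} := by
  obtain ⟨k, rfl⟩ := Nat.exists_eq_succ_of_ne_zero hn
  rw [dirichlet_one_apply (measurableSet_le measurable_const (by fun_prop)),
    dirichlet_one_apply (measurableSet_le (by fun_prop) measurable_const)]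
  congr 2
  ext x
  simp only [Set.mem_ofPred_eq, mul_sub, Finset.sum_sub_distrib, ← Finset.sum_mul,
    sum_completeToSimplex, one_mul]
  refine and_congr_right fun _ => ?_
  constructor <;> intro h <;> linarith

/-- The mirror image of `exists_polyFactor_mul_exp_le_dirichlet_one` under `x ↦ B - x`. -/
lemma exists_polyFactor_mul_exp_le_dirichlet_one_le {B : ℝ} (hB : 0 < B) {F : Measure ℝ}
    (hF : F ∈ boundedLaws B) {U ε : ℝ} (hU : 0 < U) (hε : 0 < ε) :
    ∃ η > 0, ∃ N : ℕ, ∀ (n : ℕ) (X : Fin n → ℝ), (∀ i, X i ∈ Icc 0 B) → (∃ i, X i = 0) →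
      (∀ x, |(empiricalLaw X).real (Iic x) - F.real (Iic x)| ≤ η) →
      ∀ M, min N n ≤ M → M ≤ n → ∀ u, U ≤ u → ∀ G ∈ boundedLaws B, ∫ x, x ∂G ≤ u →
      InformationTheory.klDiv F G ≠ ∞ →
      ENNReal.ofReal (polyFactor M n *
          Real.exp (-(n * ((InformationTheory.klDiv F G).toReal + ε))))
        ≤ dirichlet (fun _ : Fin n => (1 : ℝ)) {y | ∑ i, y i * X i ≤ u} := by
  have := hF.1
  have hm := measurable_const_sub_real B
  obtain ⟨η, hη, N, H⟩ := exists_polyFactor_mul_exp_le_dirichlet_one hB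
    (map_sub_mem_boundedLaws hF) (U := B - U) (by linarith) hε
  refine ⟨η, hη, N, fun n X hX ⟨i₀, hi₀⟩ hdist M hM hMn u hu G hG huG hkl => ?_⟩
  have := hG.1
  have hn0 : n ≠ 0 := by rintro rfl; exact i₀.elim0
  have := isProbabilityMeasure_empiricalLaw hn0 X
  have hle : InformationTheory.klDiv (F.map fun x => B - x) (G.map fun x => B - x)
      ≤ InformationTheory.klDiv F G := InformationTheory.klDiv_map_le (μ := F) (ν := G) hm
  have h := H n (fun i => B - X i)
    (fun i => ⟨by linarith [(hX i).2], by linarith [(hX i).1]⟩) ⟨i₀, by simp [hi₀]⟩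
    (fun x => by
      rw [empiricalLaw_comp X hm, measureReal_map_sub_Iio, measureReal_map_sub_Iio,
        sub_sub_sub_cancel_left, abs_sub_comm]
      exact hdist _)
    M hM hMn (B - u) (by linarith) _ (map_sub_mem_boundedLaws hG)
    (by rw [integral_map_sub hG]; linarith) (ne_top_of_le_ne_top hkl hle)
  rw [dirichlet_one_sub hn0] at h
  refine le_trans (ENNReal.ofReal_le_ofReal ?_) h
  have hM0 : 0 ≤ polyFactor M n := by
    have := Real.pi_pos
    unfold polyFactor
    positivity
  have := ENNReal.toReal_mono hkl hle
  gcongr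

lemma klFun_le_sq_add_one {x : ℝ} (hx : 0 ≤ x) : InformationTheory.klFun x ≤ x ^ 2 + 1 := by
  rw [InformationTheory.klFun_apply]
  rcases hx.eq_or_lt with rfl | h
  · simp
  · nlinarith [mul_le_mul_of_nonneg_left (Real.log_le_sub_one_of_pos h) hx]

/-- A domination `c • F ≤ G` bounds the density of `F` by `1 / c`, hence the relative entropy. -/
lemma klDiv_ne_top_of_smul_le {E : Type*} [MeasurableSpace E] {F G : Measure E}
    [IsFiniteMeasure F] [IsFiniteMeasure G] {c : ℝ≥0∞} (hc0 : c ≠ 0) (hc : c ≠ ∞)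
    (h : c • F ≤ G) : InformationTheory.klDiv F G ≠ ∞ := by
  have hac : F ≪ G := by
    refine Measure.AbsolutelyContinuous.mk fun S _ hS => ?_
    have := le_antisymm ((h S).trans hS.le) bot_le
    simpa [hc0] using this
  rw [InformationTheory.klDiv_eq_lintegral_klFun_of_ac hac]
  refine ((lintegral_mono_ae (g := fun _ => ENNReal.ofReal ((c⁻¹).toReal ^ 2 + 1)) ?_).trans_lt
    ?_).ne
  · filter_upwards [Measure.rnDeriv_le_one_of_le h, Measure.rnDeriv_smul_left_of_ne_top F G hc]
      with x h1 h2
    apply ENNReal.ofReal_le_ofReal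
    refine (klFun_le_sq_add_one ENNReal.toReal_nonneg).trans ?_
    rw [h2] at h1
    simp only [Pi.smul_apply, smul_eq_mul, Pi.one_apply] at h1
    have h3 : F.rnDeriv G x ≤ c⁻¹ := by
      rw [ENNReal.le_inv_iff_mul_le, mul_comm]
      exact h1
    have := ENNReal.toReal_mono (ENNReal.inv_ne_top.2 hc0) h3
    gcongr
  · rw [lintegral_const]
    exact ENNReal.mul_lt_top ENNReal.ofReal_lt_top (measure_lt_top _ _)

/-- Mixing `F` with a point mass at `B` gives a competitor of finite relative entropy. -/
lemma exists_mem_boundedLaws_klDiv_ne_top {B : ℝ} {F : Measure ℝ} (hF : F ∈ boundedLaws B)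
    {u : ℝ} (hu : u ∈ Ico 0 B) :
    ∃ G ∈ boundedLaws B, u ≤ ∫ x, x ∂G ∧ InformationTheory.klDiv F G ≠ ∞ := by
  have := hF.1
  have hB : 0 < B := hu.1.trans_lt hu.2
  have ht0 : 0 ≤ u / B := div_nonneg hu.1 hB.le
  have ht1 : 0 < 1 - u / B := sub_pos.2 ((div_lt_one hB).2 hu.2)
  set G : Measure ℝ := ENNReal.ofReal (1 - u / B) • F + ENNReal.ofReal (u / B) • Measure.dirac B
    with hG
  have hGp : IsProbabilityMeasure G := by
    constructor
    simp only [hG, Measure.add_apply, Measure.smul_apply, measure_univ, smul_eq_mul, mul_one]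
    rw [← ENNReal.ofReal_add ht1.le ht0]
    simp
  refine ⟨G, ⟨hGp, ?_⟩, ?_, ?_⟩
  · simp only [hG, Measure.add_apply, Measure.smul_apply, hF.2, smul_eq_mul, mul_zero, zero_add]
    rw [Measure.dirac_apply' _ measurableSet_Icc.compl]
    simp [hB.le]
  · have hi : Integrable (fun x : ℝ => x) (Measure.dirac B) :=
      integrable_dirac (by simp)
    rw [hG, integral_add_measure
      ((integrable_id_of_mem_boundedLaws hF).smul_measure ENNReal.ofReal_ne_top)
      (hi.smul_measure ENNReal.ofReal_ne_top), integral_smul_measure, integral_smul_measure,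
      integral_dirac, ENNReal.toReal_ofReal ht1.le, ENNReal.toReal_ofReal ht0]
    have h0 : 0 ≤ ∫ x, x ∂F := integral_nonneg_of_ae (by
      filter_upwards [ae_mem_Icc_of_mem_boundedLaws hF] with x hx using hx.1)
    have h1 : u / B * B = u := by field_simp
    simp only [smul_eq_mul, h1]
    have := mul_nonneg ht1.le h0
    linarith
  · refine klDiv_ne_top_of_smul_le (c := ENNReal.ofReal (1 - u / B)) (by simpa using ht1)
      ENNReal.ofReal_ne_top ?_
    exact Measure.le_add_right le_rfl

lemma le_mul_iInf_add_mul_iInf {α : Type*} {S T : Set α} {f g : α → ℝ≥0∞} {a c d : ℝ≥0∞}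
    (hc0 : c ≠ 0) (hc : c ≠ ∞) (hd0 : d ≠ 0) (hd : d ≠ ∞)
    (h : ∀ x ∈ S, ∀ y ∈ T, a ≤ c * f x + d * g y) :
    a ≤ c * (⨅ x ∈ S, f x) + d * (⨅ y ∈ T, g y) := by
  simp only [ENNReal.mul_iInf_of_ne hc0 hc, ENNReal.mul_iInf_of_ne hd0 hd, ENNReal.iInf_add,
    ENNReal.add_iInf]
  exact le_iInf₂ fun y hy => le_iInf₂ fun x hx => h x hx y hy

/-! ### Two independent weighted means -/

/-- By independence, the two weighted means are ordered with at least the product of the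
probabilities that they lie on the right sides of a common level `u`. -/
lemma ofReal_mul_le_of_indepFun {n₁ n₂ : ℕ} {X₁ : Fin n₁ → ℝ} {X₂ : Fin n₂ → ℝ} {Ω : Type*}
    [MeasurableSpace Ω] {P : Measure Ω} [IsProbabilityMeasure P] {L₁ : Ω → Fin n₁ → ℝ}
    {L₂ : Ω → Fin n₂ → ℝ} {D₁ : Measure (Fin n₁ → ℝ)} {D₂ : Measure (Fin n₂ → ℝ)}
    (h₁ : HasLaw L₁ D₁ P) (h₂ : HasLaw L₂ D₂ P) (hind : IndepFun L₁ L₂ P) {a b u : ℝ}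
    (ha : ENNReal.ofReal a ≤ D₁ {y | ∑ i, y i * X₁ i ≤ u})
    (hb : ENNReal.ofReal b ≤ D₂ {y | u ≤ ∑ i, y i * X₂ i}) (ha0 : 0 ≤ a) :
    a * b ≤ P.real {ω | ∑ i, L₁ ω i * X₁ i ≤ ∑ i, L₂ ω i * X₂ i} := by
  have hS₁ : MeasurableSet {y : Fin n₁ → ℝ | ∑ i, y i * X₁ i ≤ u} :=
    measurableSet_le (by fun_prop) measurable_const
  have hS₂ : MeasurableSet {y : Fin n₂ → ℝ | u ≤ ∑ i, y i * X₂ i} :=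
    measurableSet_le measurable_const (by fun_prop)
  have hsub : L₁ ⁻¹' {y | ∑ i, y i * X₁ i ≤ u} ∩ L₂ ⁻¹' {y | u ≤ ∑ i, y i * X₂ i}
      ⊆ {ω | ∑ i, L₁ ω i * X₁ i ≤ ∑ i, L₂ ω i * X₂ i} := by
    rintro ω ⟨(hω₁ : _ ≤ u), (hω₂ : u ≤ _)⟩
    exact hω₁.trans hω₂
  rw [← h₁.map_eq, Measure.map_apply_of_aemeasurable h₁.aemeasurable hS₁] at ha
  rw [← h₂.map_eq, Measure.map_apply_of_aemeasurable h₂.aemeasurable hS₂] at hb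
  have h : ENNReal.ofReal (a * b) ≤ P {ω | ∑ i, L₁ ω i * X₁ i ≤ ∑ i, L₂ ω i * X₂ i} := by
    rw [ENNReal.ofReal_mul ha0]
    refine (mul_le_mul' ha hb).trans ?_
    rw [← hind.measure_inter_preimage_eq_mul _ _ hS₁ hS₂]
    exact measure_mono hsub
  exact (ENNReal.ofReal_le_iff_le_toReal (measure_ne_top P _)).1 h

/-- Only levels between `min m₁ m₂` and `m₁` matter, where `m₁` and `m₂` are the means of `F₁` and
`F₂`: a pair of competitors separated by a level outside this interval may be replaced by one
separated by an end of the interval, with no larger relative entropies. -/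
lemma exists_competitors_of_level {B : ℝ} {F₁ F₂ G₁ G₂ : Measure ℝ} (hF₁ : F₁ ∈ boundedLaws B)
    (hF₂ : F₂ ∈ boundedLaws B) (hG₁ : G₁ ∈ boundedLaws B) (hG₂ : G₂ ∈ boundedLaws B) {u : ℝ}
    (h₁ : ∫ x, x ∂G₁ ≤ u) (h₂ : u ≤ ∫ x, x ∂G₂) :
    ∃ v ∈ Icc (min (∫ x, x ∂F₁) (∫ x, x ∂F₂)) (∫ x, x ∂F₁),
      ∃ H₁ ∈ boundedLaws B, ∃ H₂ ∈ boundedLaws B, ∫ x, x ∂H₁ ≤ v ∧ v ≤ ∫ x, x ∂H₂ ∧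
        InformationTheory.klDiv F₁ H₁ ≤ InformationTheory.klDiv F₁ G₁ ∧
        InformationTheory.klDiv F₂ H₂ ≤ InformationTheory.klDiv F₂ G₂ := by
  have := hF₁.1
  have := hF₂.1
  rcases le_total (∫ x, x ∂F₁) u with hu | hu
  · exact ⟨∫ x, x ∂F₁, ⟨min_le_left _ _, le_rfl⟩, F₁, hF₁, G₂, hG₂, le_rfl, hu.trans h₂,
      by simp, le_rfl⟩
  · rcases le_total (min (∫ x, x ∂F₁) (∫ x, x ∂F₂)) u with hu' | hu'
    · exact ⟨u, ⟨hu', hu⟩, G₁, hG₁, G₂, hG₂, h₁, h₂, le_rfl, le_rfl⟩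
    · exact ⟨_, ⟨le_rfl, min_le_left _ _⟩, G₁, hG₁, F₂, hF₂, h₁.trans hu', min_le_right _ _,
        le_rfl, by simp⟩

theorem mainTheorem7 (B : ℝ) (F₁ F₂ : Measure ℝ)
    (hF₁ : F₁ ∈ boundedLaws B) (hF₂ : F₂ ∈ boundedLaws B)
    (hm₁ : ∫ x, x ∂F₁ ∈ Ioo 0 B) (hm₂ : ∫ x, x ∂F₂ ∈ Ioo 0 B)
    (ε : ℝ) (hε : 0 < ε) :
    ∃ η : ℝ, 0 < η ∧
      ∀ (n₁ n₂ : ℕ) (X₁ : Fin n₁ → ℝ) (X₂ : Fin n₂ → ℝ),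
        (∀ i, X₁ i ∈ Icc 0 B) → (∀ i, X₂ i ∈ Icc 0 B) →
        (∃ i, X₁ i = 0) → (∃ i, X₂ i = B) →
        cdfDist (empiricalLaw X₁) F₁ ≤ η → cdfDist (empiricalLaw X₂) F₂ ≤ η →
        ∀ (Ω : Type*) [MeasurableSpace Ω] (P : Measure Ω) [IsProbabilityMeasure P]
          (L₁ : Ω → Fin n₁ → ℝ) (L₂ : Ω → Fin n₂ → ℝ),
          HasLaw L₁ (dirichlet (fun _ => 1)) P → HasLaw L₂ (dirichlet (fun _ => 1)) P →
          IndepFun L₁ L₂ P →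
          polyFactor (min (2 + ⌊2 / η⌋₊) n₁) n₁ * polyFactor (min (2 + ⌊2 / η⌋₊) n₂) n₂ *
              Real.exp
                (-(⨅ μ ∈ Icc (0 : ℝ) B,
                    ((n₁ : ℝ≥0∞) * KinfMinus B F₁ μ + (n₂ : ℝ≥0∞) * KinfPlus B F₂ μ)).toReal
                  - ((n₁ : ℝ) + n₂) * ε)
            ≤ P.real {ω | ∑ i, L₁ ω i * X₁ i ≤ ∑ i, L₂ ω i * X₂ i} := by
  have hB : 0 < B := hm₁.1.trans hm₁.2
  have := hF₁.1
  have := hF₂.1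
  obtain ⟨η₁, hη₁, N₁, H₁⟩ := exists_polyFactor_mul_exp_le_dirichlet_one_le hB hF₁
    (lt_min hm₁.1 hm₂.1) hε
  obtain ⟨η₂, hη₂, N₂, H₂⟩ := exists_polyFactor_mul_exp_le_dirichlet_one hB hF₂ hm₁.2 hε
  -- The last term makes `2 + ⌊2 / η⌋` at least as large as both numbers of cells.
  let η : ℝ := min (min η₁ η₂) (2 / (N₁ + N₂ + 1))
  have hη : 0 < η := lt_min (lt_min hη₁ hη₂) (by positivity)
  have hηN : N₁ + N₂ + 1 ≤ ⌊2 / η⌋₊ := by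
    rw [Nat.le_floor_iff (by positivity), le_div_iff₀ hη]
    have := (le_div_iff₀ (by positivity)).1 (min_le_right (min η₁ η₂) (2 / ((N₁ : ℝ) + N₂ + 1)))
    push_cast
    linarith
  refine ⟨η, hη, fun n₁ n₂ X₁ X₂ hX₁ hX₂ hz hb hd₁ hd₂ Ω _ P _ L₁ L₂ hL₁ hL₂ hind => ?_⟩
  have hn₁ : n₁ ≠ 0 := by rintro rfl; exact hz.choose.elim0
  have hn₂ : n₂ ≠ 0 := by rintro rfl; exact hb.choose.elim0
  have := isProbabilityMeasure_empiricalLaw hn₁ X₁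
  have := isProbabilityMeasure_empiricalLaw hn₂ X₂
  have hc₁ : 0 < polyFactor (min (2 + ⌊2 / η⌋₊) n₁) n₁ := polyFactor_pos (by omega) hn₁
  have hc₂ : 0 < polyFactor (min (2 + ⌊2 / η⌋₊) n₂) n₂ := polyFactor_pos (by omega) hn₂
  set c₁ := polyFactor (min (2 + ⌊2 / η⌋₊) n₁) n₁
  set c₂ := polyFactor (min (2 + ⌊2 / η⌋₊) n₂) n₂
  set Q := P.real {ω | ∑ i, L₁ ω i * X₁ i ≤ ∑ i, L₂ ω i * X₂ i}
  have hpair : ∀ u : ℝ, ∀ G₁ ∈ boundedLaws B, ∀ G₂ ∈ boundedLaws B, ∫ x, x ∂G₁ ≤ u →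
      u ≤ ∫ x, x ∂G₂ → InformationTheory.klDiv F₁ G₁ ≠ ∞ → InformationTheory.klDiv F₂ G₂ ≠ ∞ →
      c₁ * c₂ * Real.exp (-(n₁ * (InformationTheory.klDiv F₁ G₁).toReal
        + n₂ * (InformationTheory.klDiv F₂ G₂).toReal) - ((n₁ : ℝ) + n₂) * ε) ≤ Q := by
    intro u G₁ hG₁ G₂ hG₂ hu₁ hu₂ hk₁ hk₂
    obtain ⟨v, hv, K₁, hK₁, K₂, hK₂, hv₁, hv₂, hle₁, hle₂⟩ :=
      exists_competitors_of_level hF₁ hF₂ hG₁ hG₂ hu₁ hu₂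
    have h₁ := H₁ n₁ X₁ hX₁ hz
      (fun x => (abs_measureReal_Iic_sub_le_cdfDist _ F₁ x).trans
        (hd₁.trans ((min_le_left _ _).trans (min_le_left _ _))))
      (min (2 + ⌊2 / η⌋₊) n₁) (by omega) (min_le_right _ _) v hv.1 K₁ hK₁ hv₁
      (ne_top_of_le_ne_top hk₁ hle₁)
    have h₂ := H₂ n₂ X₂ hX₂ hb
      (abs_measureReal_Iio_sub_le fun x => (abs_measureReal_Iic_sub_le_cdfDist _ F₂ x).trans
        (hd₂.trans ((min_le_left _ _).trans (min_le_right _ _))))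
      (min (2 + ⌊2 / η⌋₊) n₂) (by omega) (min_le_right _ _) v hv.2 K₂ hK₂ hv₂
      (ne_top_of_le_ne_top hk₂ hle₂)
    refine le_trans ?_ (ofReal_mul_le_of_indepFun hL₁ hL₂ hind h₁ h₂ (by positivity))
    rw [mul_mul_mul_comm, ← Real.exp_add]
    refine mul_le_mul_of_nonneg_left (Real.exp_le_exp.2 ?_) (by positivity)
    have e₁ := mul_le_mul_of_nonneg_left (ENNReal.toReal_mono hk₁ hle₁) n₁.cast_nonneg
    have e₂ := mul_le_mul_of_nonneg_left (ENNReal.toReal_mono hk₂ hle₂) n₂.cast_nonneg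
    linarith
  set I := ⨅ μ ∈ Icc (0 : ℝ) B, ((n₁ : ℝ≥0∞) * KinfMinus B F₁ μ + (n₂ : ℝ≥0∞) * KinfPlus B F₂ μ)
  obtain ⟨G, hG, hGm, hGk⟩ := exists_mem_boundedLaws_klDiv_ne_top hF₂ ⟨hm₁.1.le, hm₁.2⟩
  have hself : InformationTheory.klDiv F₁ F₁ ≠ ∞ := by simp
  have hQ : 0 < Q := lt_of_lt_of_le (by positivity)
    (hpair _ F₁ hF₁ G hG le_rfl hGm hself hGk)
  -- Finiteness matters: otherwise `I.toReal` would be the junk value `0`.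
  have hI : I ≠ ∞ := by
    refine ne_top_of_le_ne_top ?_ (iInf₂_le (∫ x, x ∂F₁) ⟨hm₁.1.le, hm₁.2.le⟩)
    refine ENNReal.add_ne_top.2 ⟨ENNReal.mul_ne_top (ENNReal.natCast_ne_top _) ?_,
      ENNReal.mul_ne_top (ENNReal.natCast_ne_top _) ?_⟩
    · exact ne_top_of_le_ne_top hself (iInf₂_le F₁ ⟨hF₁, le_rfl⟩)
    · exact ne_top_of_le_ne_top hGk (iInf₂_le G ⟨hG, hGm⟩)
  have hlow : ENNReal.ofReal (Real.log (c₁ * c₂ / Q) - ((n₁ : ℝ) + n₂) * ε) ≤ I := by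
    refine le_iInf₂ fun u _ => le_mul_iInf_add_mul_iInf (by exact_mod_cast hn₁)
      (ENNReal.natCast_ne_top _) (by exact_mod_cast hn₂) (ENNReal.natCast_ne_top _)
      fun G₁ hG₁ G₂ hG₂ => ?_
    by_cases hk₁ : InformationTheory.klDiv F₁ G₁ = ∞
    · simp [hk₁, ENNReal.mul_top, hn₁]
    by_cases hk₂ : InformationTheory.klDiv F₂ G₂ = ∞
    · simp [hk₂, ENNReal.mul_top, hn₂]
    have h := hpair u G₁ hG₁.1 G₂ hG₂.1 hG₁.2 hG₂.2 hk₁ hk₂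
    have h' := Real.log_le_log (by positivity) h
    rw [Real.log_mul (by positivity) (Real.exp_ne_zero _), Real.log_exp] at h'
    rw [Real.log_div (by positivity) hQ.ne']
    refine ENNReal.ofReal_le_of_le_toReal ?_
    rw [ENNReal.toReal_add (ENNReal.mul_ne_top (ENNReal.natCast_ne_top _) hk₁)
      (ENNReal.mul_ne_top (ENNReal.natCast_ne_top _) hk₂), ENNReal.toReal_mul, ENNReal.toReal_mul,
      ENNReal.toReal_natCast, ENNReal.toReal_natCast]
    linarith
  have hreal := (ENNReal.ofReal_le_iff_le_toReal hI).1 hlow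
  calc c₁ * c₂ * Real.exp (-I.toReal - ((n₁ : ℝ) + n₂) * ε)
      ≤ c₁ * c₂ * Real.exp (-Real.log (c₁ * c₂ / Q)) := by
        gcongr
        linarith
    _ = Q := by
        rw [Real.exp_neg, Real.exp_log (by positivity)]
        field_simp
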